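/- Let $k\ge 3$ and $n>2k$ be integers, and let $0\le p<1$. Partition a set of $n$ vertices into $k$ sets $V_1,\dots,V_k$, each of size $\lfloor n/k\rfloor$ or $\lceil n/k\rceil$. Form a random graph on these vertices by including each pair of vertices lying in two different sets as an edge independently with probability $p$, with no edges inside any $V_i$ (a random Turán $k$-partite graph). Let $P$ be the probability that this random graph has diameter exactly $2$ (a disconnected graph having infinite diameter). Then $$P\;\ge\;1-\frac{n^2(1-p^2)^{n(1-1/k)-1}}{2k}\Bigl(1+(k-1)(1-p^2)^{-n/k-1}\Bigr)\Bigl(1+\frac kn\Bigr)$$ and $$P\;\le\;\frac{2k}{n^2(1-p^2)^{n(1-1/k)+1}}\Bigl(1+(k-1)(1-p^2)^{1-n/k}(1-p)\Bigr)^{-1}\Bigl(1-\frac{2k}{n}\Bigr)^{-1}+\frac{4k^3\Bigl(1+\frac{p^3}{1-p}\Bigr)^{n(1-1/k)+1}(1-p^2)^{-2}}{n(k-1)}\Bigl(1-\frac{2k}{n}\Bigr)^{-4}.$$ -/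

import Mathlib

/-- The law of the random subgraph of `H` in which each edge of `H` is kept independently with
probability `p` (and non-edges of `H` are never edges). -/
noncomputable def randomSubgraph {V : Type*} (H : SimpleGraph V) (p : unitInterval) :
    MeasureTheory.Measure (SimpleGraph V) :=
  (ProbabilityTheory.setBernoulli H.edgeSet p).map SimpleGraph.fromEdgeSet

/-- The complete multipartite graph whose parts are the fibres of `part`. -/
def multipartiteGraph {V ι : Type*} (part : V → ι) : SimpleGraph V :=
  (⊤ : SimpleGraph ι).comap part

/-- The fibres of `part` divide the `n` vertices into `k` sets, each of size `⌊n/k⌋` or `⌈n/k⌉`. -/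
def IsTuranPartition {V : Type*} [Fintype V] (k : ℕ) (part : V → Fin k) : Prop :=
  ∀ i : Fin k,
    (part ⁻¹' {i}).ncard = ⌊(Fintype.card V : ℝ) / (k : ℝ)⌋₊ ∨
    (part ⁻¹' {i}).ncard = ⌈(Fintype.card V : ℝ) / (k : ℝ)⌉₊

/-- The probability that a random Turán `k`-partite graph with the given parts, whose edges between
different parts are chosen independently with probability `p`, has diameter `2`. -/
noncomputable def probDiamTwo {V : Type*} {k : ℕ} (part : V → Fin k) (p : unitInterval) : ℝ :=
  (randomSubgraph (multipartiteGraph part) p).real {G : SimpleGraph V | G.ediam = 2}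

/-! Call a pair of distinct vertices bad if it is non-adjacent and has no common neighbour. Some
part contains two vertices, so the diameter is never below 2, and almost surely it equals 2 exactly
when no pair is bad (`probDiamTwo_eq`). Let X count the bad ordered pairs and let E be its mean.
Each bad pair is counted twice, so the union bound gives P ≥ 1 - E/2, while Chebyshev's inequality
gives P ≤ Var X / E². Both bounds need E, estimated from part sizes within 1 of m = n/k
(`badDegree_le`, `le_badDegree`).

For the variance, the joint probability of two bad pairs is compared with the product of their
probabilities. Coinciding pairs contribute at most 2E, which becomes the term 2/E. Pairs sharing one
vertex cost a factor K/(1-p²)² with K = (1+p³/(1-p))^(n(1-1/k)+1), but their weight is only of order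
E²/m (`edgeLaw_real_badPair_inter_badPair_le`). Disjoint pairs interact only through the four edges
joining them, at a cost of 1+4p³/(1-p²)² (`edgeLaw_real_badPair_inter_badPair_le_of_disjoint`).
Bernoulli's inequality bounds p³ by a multiple of K/n, so `correlation_error_le` merges both
excesses into one error term. -/

open MeasureTheory ProbabilityTheory

/-! ### Independence of events depending on disjoint sets of coordinates. -/

section SetBernoulli

variable {ι : Type*}

/-- Whether a random set belongs to `A` is decided by its trace on `S`. -/
def DeterminedBy (A : Set (Set ι)) (S : Set ι) : Prop :=
  ∀ s t : Set ι, (∀ i ∈ S, i ∈ s ↔ i ∈ t) → s ∈ A → t ∈ A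

lemma DeterminedBy.mono {A : Set (Set ι)} {S T : Set ι} (h : DeterminedBy A S) (hST : S ⊆ T) :
    DeterminedBy A T := fun s t hst ↦ h s t fun i hi ↦ hst i (hST hi)

lemma DeterminedBy.compl {A : Set (Set ι)} {S : Set ι} (h : DeterminedBy A S) :
    DeterminedBy Aᶜ S := fun s t hst hs ht ↦ hs (h t s (fun i hi ↦ (hst i hi).symm) ht)

lemma DeterminedBy.inter {A B : Set (Set ι)} {S T : Set ι} (hA : DeterminedBy A S)
    (hB : DeterminedBy B T) : DeterminedBy (A ∩ B) (S ∪ T) := fun s t hst hs ↦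
  ⟨hA s t (fun i hi ↦ hst i (.inl hi)) hs.1, hB s t (fun i hi ↦ hst i (.inr hi)) hs.2⟩

lemma DeterminedBy.union {A B : Set (Set ι)} {S T : Set ι} (hA : DeterminedBy A S)
    (hB : DeterminedBy B T) : DeterminedBy (A ∪ B) (S ∪ T) := by
  simpa [Set.compl_inter] using (hA.compl.inter hB.compl).compl

lemma DeterminedBy.iInter {α : Type*} {A : α → Set (Set ι)} {S : α → Set ι} {J : Finset α}
    (hA : ∀ j ∈ J, DeterminedBy (A j) (S j)) :
    DeterminedBy (⋂ j ∈ J, A j) (⋃ j ∈ J, S j) := by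
  intro s t hst hs
  simp only [Set.mem_iInter] at hs ⊢
  exact fun j hj ↦ hA j hj s t (fun i hi ↦ hst i (Set.mem_biUnion hj hi)) (hs j hj)

lemma determinedBy_mem (i : ι) : DeterminedBy {s : Set ι | i ∈ s} {i} :=
  fun _ _ h hs ↦ (h i rfl).1 hs

variable {u : Set ι} {p : unitInterval}

lemma measurableSet_setSet [Finite ι] (A : Set (Set ι)) : MeasurableSet A := A.toFinite.measurableSet

lemma iIndepFun_mem_setBernoulli :
    iIndepFun (fun (i : ι) (s : Set ι) ↦ i ∈ s) (setBernoulli u p) := by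
  have h := iIndepFun_infinitePi
    (P := fun i : ι ↦ unitInterval.toNNReal p • Measure.dirac (i ∈ u) +
      unitInterval.toNNReal (unitInterval.symm p) • Measure.dirac False)
    (X := fun _ x ↦ x) (fun _ ↦ measurable_id)
  rw [iIndepFun_iff_measure_inter_preimage_eq_mul] at h ⊢
  intro S sets hsets
  have h1 := h S hsets
  simp only [setBernoulli_apply']
  simpa only [Set.preimage_iInter, Set.preimage_preimage, Set.mem_ofPred_eq] using h1

variable [Finite ι]

lemma setBernoulli_real_inter {A B : Set (Set ι)} {S T : Set ι} (hA : DeterminedBy A S)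
    (hB : DeterminedBy B T) (hST : Disjoint S T) :
    (setBernoulli u p).real (A ∩ B) =
      (setBernoulli u p).real A * (setBernoulli u p).real B := by
  classical
  have := Fintype.ofFinite ι
  have h := (iIndepFun_mem_setBernoulli (u := u) (p := p)).indepFun_finset S.toFinset T.toFinset
    (by simpa using hST) (fun i ↦ measurable_of_finite _)
  -- An event determined by `S` is the preimage of its own image under restriction to `S`, which
  -- brings it into the form required by independence of coordinate families.
  have key : ∀ {A : Set (Set ι)} {S : Set ι}, DeterminedBy A S →
      A = (fun s (i : S.toFinset) ↦ (i : ι) ∈ s) ⁻¹'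
        ((fun s (i : S.toFinset) ↦ (i : ι) ∈ s) '' A) := by
    intro A S hA
    refine (Set.subset_preimage_image _ _).antisymm ?_
    rintro t ⟨s, hs, hst⟩
    refine hA s t (fun i hi ↦ ?_) hs
    exact iff_of_eq (congrFun hst ⟨i, by simpa using hi⟩)
  have h2 := h.measure_inter_preimage_eq_mul (s := (fun s (i : S.toFinset) ↦ (i : ι) ∈ s) '' A)
    (t := (fun s (i : T.toFinset) ↦ (i : ι) ∈ s) '' B) (Set.toFinite _).measurableSet
    (Set.toFinite _).measurableSet
  rw [← key hA, ← key hB] at h2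
  simp [measureReal_def, h2]

lemma setBernoulli_real_biInter {α : Type*} {A : α → Set (Set ι)} {S : α → Set ι} {J : Finset α}
    (hA : ∀ j ∈ J, DeterminedBy (A j) (S j)) (hS : (J : Set α).PairwiseDisjoint S) :
    (setBernoulli u p).real (⋂ j ∈ J, A j) = ∏ j ∈ J, (setBernoulli u p).real (A j) := by
  classical
  induction J using Finset.induction_on with
  | empty => simp
  | insert a J ha ih =>
    rw [Finset.prod_insert ha, Finset.set_biInter_insert,
      setBernoulli_real_inter (hA a (by simp))
        (DeterminedBy.iInter fun j hj ↦ hA j (by simp [hj])), ih]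
    · exact fun j hj ↦ hA j (by simp [hj])
    · exact hS.subset (by simp)
    · simp only [Set.disjoint_iUnion_right]
      intro j hj
      exact hS (by simp) (by simp [hj]) (by rintro rfl; exact ha hj)

lemma setBernoulli_real_mem (i : ι) :
    (setBernoulli u p).real {s | i ∈ s} = u.indicator (fun _ ↦ (p : ℝ)) i := by
  have h : ((fun q : ι → Prop ↦ {i | q i}) ⁻¹' {s | i ∈ s}) =
      cylinder (α := fun _ : ι ↦ Prop) {i} {fun _ ↦ True} := by
    ext; simp [funext_iff]
  rw [measureReal_def, setBernoulli_apply', h]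
  by_cases hi : i ∈ u <;> simp [Measure.infinitePi_cylinder, hi]

lemma setBernoulli_real_compl (A : Set (Set ι)) :
    (setBernoulli u p).real Aᶜ = 1 - (setBernoulli u p).real A :=
  probReal_compl_eq_one_sub (measurableSet_setSet A)

lemma setBernoulli_real_inter_compl {A B : Set (Set ι)} {S T : Set ι} (hA : DeterminedBy A S)
    (hB : DeterminedBy B T) (hST : Disjoint S T) :
    (setBernoulli u p).real (A ∩ B)ᶜ =
      1 - (setBernoulli u p).real A * (setBernoulli u p).real B := by
  rw [setBernoulli_real_compl, setBernoulli_real_inter hA hB hST]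

lemma setBernoulli_real_union {A B : Set (Set ι)} {S T : Set ι} (hA : DeterminedBy A S)
    (hB : DeterminedBy B T) (hST : Disjoint S T) :
    (setBernoulli u p).real (A ∪ B) =
      1 - (1 - (setBernoulli u p).real A) * (1 - (setBernoulli u p).real B) := by
  rw [← setBernoulli_real_compl, ← setBernoulli_real_compl,
    ← setBernoulli_real_inter_compl hA.compl hB.compl hST, Set.compl_inter, compl_compl,
    compl_compl]

end SetBernoulli

/-! ### Bad pairs for arbitrary edge probabilities. -/

section BadPair

variable {V : Type*} [Fintype V] [DecidableEq V] {u : Set (Sym2 V)} {p : unitInterval}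

/-- The edge sets in which `a` and `b` are neither adjacent nor have a common neighbour. -/
def badPair {V : Type*} (a b : V) : Set (Set (Sym2 V)) :=
  {s | s(a, b) ∉ s ∧ ∀ c, c ≠ a → c ≠ b → ¬ (s(a, c) ∈ s ∧ s(b, c) ∈ s)}

lemma badPair_comm {V : Type*} (a b : V) : badPair a b = badPair b a := by
  ext s
  simp only [badPair, Set.mem_ofPred_eq, Sym2.eq_swap (a := a) (b := b)]
  grind

/-- The probability that the pair `ab` is an edge. -/
noncomputable def edgeProb (u : Set (Sym2 V)) (p : unitInterval) (a b : V) : ℝ :=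
  u.indicator (fun _ ↦ (p : ℝ)) s(a, b)

/-- The edge sets in which `a` and `b` are adjacent. -/
def hasEdge (a b : V) : Set (Set (Sym2 V)) := {s | s(a, b) ∈ s}

omit [Fintype V] [DecidableEq V] in
lemma determinedBy_hasEdge (a b : V) : DeterminedBy (hasEdge a b) {s(a, b)} :=
  determinedBy_mem _

omit [DecidableEq V] in
lemma setBernoulli_real_hasEdge (a b : V) :
    (setBernoulli u p).real (hasEdge a b) = edgeProb u p a b :=
  setBernoulli_real_mem _

omit [DecidableEq V] in
lemma setBernoulli_real_hasEdge_compl (a b : V) :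
    (setBernoulli u p).real (hasEdge a b)ᶜ = 1 - edgeProb u p a b := by
  rw [setBernoulli_real_compl, setBernoulli_real_hasEdge]

/-- Events attached to the edges inside `T` and to the edges from `T` to each vertex outside `T`
are independent. -/
lemma setBernoulli_real_inter_stars {T : Finset V} {A : Set (Set (Sym2 V))}
    {B : V → Set (Set (Sym2 V))} (hA : DeterminedBy A {e | ∃ x ∈ T, ∃ y ∈ T, e = s(x, y)})
    (hB : ∀ d ∉ T, DeterminedBy (B d) {e | ∃ x ∈ T, e = s(x, d)}) :
    (setBernoulli u p).real (A ∩ ⋂ d ∈ Tᶜ, B d) =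
      (setBernoulli u p).real A * ∏ d ∈ Tᶜ, (setBernoulli u p).real (B d) := by
  have hB' : ∀ d ∈ Tᶜ, DeterminedBy (B d) {e | ∃ x ∈ T, e = s(x, d)} := fun d hd ↦
    hB d (by simpa using hd)
  rw [setBernoulli_real_inter hA (DeterminedBy.iInter hB'), setBernoulli_real_biInter hB']
  · intro d hd d' hd' hdd
    simp only [Finset.coe_compl, Set.mem_compl_iff, Finset.mem_coe] at hd hd'
    refine Set.disjoint_left.2 ?_
    rintro e ⟨x, hx, rfl⟩ ⟨y, hy, h⟩
    rcases Sym2.eq_iff.1 h with ⟨-, h⟩ | ⟨h, -⟩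
    · exact hdd h
    · exact hd' (h ▸ hx)
  · simp only [Set.disjoint_iUnion_right]
    intro d hd
    refine Set.disjoint_left.2 ?_
    rintro e ⟨x, hx, y, hy, rfl⟩ ⟨z, hz, h⟩
    simp only [Finset.mem_compl] at hd
    rcases Sym2.eq_iff.1 h with ⟨-, h⟩ | ⟨h, -⟩
    · exact hd (h ▸ hy)
    · exact hd (h ▸ hx)

/-- Paths of length 2 from `a` to `b` through different midpoints use disjoint edges, so the
probability factors exactly. -/
lemma setBernoulli_real_badPair {a b : V} (hab : a ≠ b) :
    (setBernoulli u p).real (badPair a b) =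
      (1 - edgeProb u p a b) * ∏ d ∈ ({a, b} : Finset V)ᶜ,
        (1 - edgeProb u p a d * edgeProb u p b d) := by
  have h : badPair a b =
      (hasEdge a b)ᶜ ∩ ⋂ d ∈ ({a, b} : Finset V)ᶜ, (hasEdge a d ∩ hasEdge b d)ᶜ := by
    ext s; simp [badPair, hasEdge]
  rw [h, setBernoulli_real_inter_stars, setBernoulli_real_hasEdge_compl]
  · congr 1
    refine Finset.prod_congr rfl fun d hd ↦ ?_
    rw [setBernoulli_real_inter_compl (determinedBy_hasEdge _ _) (determinedBy_hasEdge _ _),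
      setBernoulli_real_hasEdge, setBernoulli_real_hasEdge]
    simp at hd
    simp; grind
  · refine (determinedBy_hasEdge a b).compl.mono ?_
    simp
  · intro d hd
    refine ((determinedBy_hasEdge a d).inter (determinedBy_hasEdge b d)).compl.mono ?_
    intro e; simp; grind

/-- The edge `bc` plays no role: a path through it from `a` would need `ab` or `ac`, both absent.
What remains splits over the midpoints `d` outside the triple. -/
lemma setBernoulli_real_badPair_inter_badPair_le {a b c : V} (hab : a ≠ b) (hac : a ≠ c)
    (hbc : b ≠ c) :
    (setBernoulli u p).real (badPair a b ∩ badPair a c) ≤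
      (1 - edgeProb u p a b) * (1 - edgeProb u p a c) * ∏ d ∈ ({a, b, c} : Finset V)ᶜ,
        (1 - edgeProb u p a d * (1 - (1 - edgeProb u p b d) * (1 - edgeProb u p c d))) := by
  have h : badPair a b ∩ badPair a c ⊆ ((hasEdge a b)ᶜ ∩ (hasEdge a c)ᶜ) ∩
      ⋂ d ∈ ({a, b, c} : Finset V)ᶜ, (hasEdge a d ∩ (hasEdge b d ∪ hasEdge c d))ᶜ := by
    intro s; simp [badPair, hasEdge]; grind
  refine (measureReal_mono h).trans_eq ?_
  rw [setBernoulli_real_inter_stars, setBernoulli_real_inter (determinedBy_hasEdge a b).compl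
    (determinedBy_hasEdge a c).compl, setBernoulli_real_hasEdge_compl,
    setBernoulli_real_hasEdge_compl]
  · congr 1
    refine Finset.prod_congr rfl fun d hd ↦ ?_
    simp at hd
    rw [setBernoulli_real_inter_compl (determinedBy_hasEdge _ _)
      ((determinedBy_hasEdge _ _).union (determinedBy_hasEdge _ _)), setBernoulli_real_union
      (determinedBy_hasEdge _ _) (determinedBy_hasEdge _ _),
      setBernoulli_real_hasEdge, setBernoulli_real_hasEdge, setBernoulli_real_hasEdge]
    all_goals simp; grind
  · simp; grind
  · refine ((determinedBy_hasEdge a b).compl.inter (determinedBy_hasEdge a c).compl).mono ?_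
    intro e; simp; grind
  · intro d hd
    refine ((determinedBy_hasEdge a d).inter
      ((determinedBy_hasEdge b d).union (determinedBy_hasEdge c d))).compl.mono ?_
    intro e; simp; grind

/-- The forbidden paths inside the quadruple are pairs of consecutive edges of the 4-cycle `a c b
d`. Avoiding all four of them means that one of the two opposite pairs {`ac`, `bd`}, {`bc`, `ad`} is
entirely absent, which makes the probability computable. -/
lemma setBernoulli_real_badPair_inter_badPair_le_of_disjoint {a b c d : V} (hab : a ≠ b)
    (hac : a ≠ c) (had : a ≠ d) (hbc : b ≠ c) (hbd : b ≠ d) (hcd : c ≠ d) :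
    (setBernoulli u p).real (badPair a b ∩ badPair c d) ≤
      (1 - edgeProb u p a b) * (1 - edgeProb u p c d) *
      (1 - (1 - (1 - edgeProb u p a c) * (1 - edgeProb u p b d)) *
        (1 - (1 - edgeProb u p b c) * (1 - edgeProb u p a d))) *
      ∏ e ∈ ({a, b, c, d} : Finset V)ᶜ,
        ((1 - edgeProb u p a e * edgeProb u p b e) *
          (1 - edgeProb u p c e * edgeProb u p d e)) := by
  have h : badPair a b ∩ badPair c d ⊆ (((hasEdge a b)ᶜ ∩ (hasEdge c d)ᶜ) ∩
      ((hasEdge a c ∪ hasEdge b d) ∩ (hasEdge b c ∪ hasEdge a d))ᶜ) ∩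
      ⋂ e ∈ ({a, b, c, d} : Finset V)ᶜ,
        ((hasEdge a e ∩ hasEdge b e)ᶜ ∩ (hasEdge c e ∩ hasEdge d e)ᶜ) := by
    rintro s ⟨⟨h1, h2⟩, h3, h4⟩
    have e1 := h2 c hac.symm hbc.symm
    have e2 := h2 d had.symm hbd.symm
    have e3 := h4 a hac had
    have e4 := h4 b hbc hbd
    rw [Sym2.eq_swap (a := c), Sym2.eq_swap (a := d)] at e3 e4
    simp only [hasEdge, Set.mem_inter_iff, Set.mem_compl_iff, Set.mem_ofPred_eq, Set.mem_union,
      Set.mem_iInter, Finset.mem_compl, Finset.mem_insert, Finset.mem_singleton]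
    grind
  refine (measureReal_mono h).trans_eq ?_
  have hc := ((determinedBy_hasEdge a c).union (determinedBy_hasEdge b d))
  have hd := ((determinedBy_hasEdge b c).union (determinedBy_hasEdge a d))
  have hs := (determinedBy_hasEdge a b).compl.inter (determinedBy_hasEdge c d).compl
  rw [setBernoulli_real_inter_stars, setBernoulli_real_inter hs (hc.inter hd).compl,
    setBernoulli_real_inter_compl hc hd, setBernoulli_real_inter (determinedBy_hasEdge a b).compl
    (determinedBy_hasEdge c d).compl, setBernoulli_real_hasEdge_compl,
    setBernoulli_real_hasEdge_compl,
    setBernoulli_real_union (determinedBy_hasEdge a c) (determinedBy_hasEdge b d),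
    setBernoulli_real_union (determinedBy_hasEdge b c) (determinedBy_hasEdge a d)]
  · simp only [setBernoulli_real_hasEdge]
    congr 1
    refine Finset.prod_congr rfl fun e he ↦ ?_
    simp only [Finset.mem_compl, Finset.mem_insert, Finset.mem_singleton, not_or] at he
    have h1 := (determinedBy_hasEdge a e).inter (determinedBy_hasEdge b e)
    have h2 := (determinedBy_hasEdge c e).inter (determinedBy_hasEdge d e)
    rw [setBernoulli_real_inter h1.compl h2.compl,
      setBernoulli_real_inter_compl (determinedBy_hasEdge _ _) (determinedBy_hasEdge _ _),
      setBernoulli_real_inter_compl (determinedBy_hasEdge _ _) (determinedBy_hasEdge _ _)]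
    · simp only [setBernoulli_real_hasEdge]
    all_goals simp; grind
  · simp; grind
  · simp; grind
  · simp; grind
  · simp; grind
  · simp; grind
  · refine (hs.inter (hc.inter hd).compl).mono ?_
    intro e; simp; grind
  · intro e he
    refine (((determinedBy_hasEdge a e).inter (determinedBy_hasEdge b e)).compl.inter
      ((determinedBy_hasEdge c e).inter (determinedBy_hasEdge d e)).compl).mono ?_
    intro f; simp; grind

end BadPair

/-! ### Correlation of two bad pairs in the multipartite graph. -/

section Multipartite

variable {V ι : Type*} [Fintype V] [DecidableEq V] [DecidableEq ι] (part : V → ι)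
  (p : unitInterval)

omit [Fintype V] [DecidableEq V] in
lemma edgeProb_multipartiteGraph (a b : V) :
    edgeProb (multipartiteGraph part).edgeSet p a b = if part a = part b then 0 else (p : ℝ) := by
  by_cases h : part a = part b <;> simp [edgeProb, multipartiteGraph, h]

/-- The number of vertices that lie in neither of the parts `i` and `j`. -/
def outsideCard (i j : ι) : ℕ := Finset.card {v : V | part v ≠ i ∧ part v ≠ j}

/-- The probability that two given distinct vertices of the parts `i` and `j` are neither adjacent
nor have a common neighbour. -/
noncomputable def badWeight (i j : ι) : ℝ :=
  (if i = j then 1 else 1 - (p : ℝ)) * (1 - (p : ℝ) ^ 2) ^ outsideCard part i j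

/-- The law of the edge set of the random multipartite graph. -/
noncomputable abbrev edgeLaw {V ι : Type*} (part : V → ι) (p : unitInterval) :
    Measure (Set (Sym2 V)) :=
  setBernoulli (multipartiteGraph part).edgeSet p

lemma edgeLaw_real_badPair {a b : V} (hab : a ≠ b) :
    (edgeLaw part p).real (badPair a b) = badWeight part p (part a) (part b) := by
  rw [edgeLaw, setBernoulli_real_badPair hab, badWeight]
  simp only [edgeProb_multipartiteGraph]
  congr 1
  · split_ifs <;> simp
  · have h : ∀ d : V, 1 - (if part a = part d then 0 else (p : ℝ)) *
        (if part b = part d then 0 else (p : ℝ)) =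
        if part d ≠ part a ∧ part d ≠ part b then 1 - (p : ℝ) ^ 2 else 1 := by
      intro d
      by_cases h1 : part a = part d
      · simp [h1]
      · by_cases h2 : part b = part d
        · simp [h2]
        · rw [if_neg h1, if_neg h2, if_pos ⟨Ne.symm h1, Ne.symm h2⟩]; ring
    simp only [h]
    -- The factors at `a` and `b` equal 1, so the product may run over all vertices.
    rw [Finset.prod_subset (Finset.subset_univ _), Finset.prod_ite, Finset.prod_const_one,
      mul_one, Finset.prod_const, outsideCard]
    intro d _ hd
    simp only [Finset.mem_compl, Finset.mem_insert, Finset.mem_singleton, not_not] at hd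
    rcases hd with rfl | rfl <;> simp

variable (hp : (p : ℝ) < 1)
include hp

lemma one_sub_sq_pos : 0 < 1 - (p : ℝ) ^ 2 := by
  have := p.2.1
  nlinarith

omit [Fintype V] [DecidableEq V] in
lemma one_sub_edgeProb_mul_pos (a b c d : V) :
    0 < 1 - edgeProb (multipartiteGraph part).edgeSet p a b *
      edgeProb (multipartiteGraph part).edgeSet p c d := by
  have := one_sub_sq_pos p hp
  simp only [edgeProb_multipartiteGraph]
  split_ifs <;> nlinarith

/-- The comparison is made midpoint by midpoint, and only midpoints outside the part of `a` can lose
a factor. The factor (1-p²)² pays for the midpoint `c` of `ab` and the midpoint `b` of `ac`, which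
occur only in the separate probabilities. -/
lemma edgeLaw_real_badPair_inter_badPair_le {a b c : V} (hab : a ≠ b) (hac : a ≠ c)
    (hbc : b ≠ c) :
    (1 - (p : ℝ) ^ 2) ^ 2 * (edgeLaw part p).real (badPair a b ∩ badPair a c) ≤
      (1 + (p : ℝ) ^ 3 / (1 - p)) ^ outsideCard part (part a) (part a) *
      ((edgeLaw part p).real (badPair a b) * (edgeLaw part p).real (badPair a c)) := by
  have hx := one_sub_sq_pos p hp
  have hp0 : (0 : ℝ) ≤ p := p.2.1
  have hq : 0 < 1 - (p : ℝ) := by linarith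
  set R : ℝ := 1 + (p : ℝ) ^ 3 / (1 - p) with hR
  have hR1 : 1 ≤ R := le_add_of_nonneg_right (by positivity)
  have hE := edgeProb_multipartiteGraph part p
  have hpos := one_sub_edgeProb_mul_pos part p hp
  set W := edgeProb (multipartiteGraph part).edgeSet p with hW
  have hW0 : ∀ a b, 0 ≤ W a b := fun a b ↦ by rw [hE]; split_ifs <;> linarith
  have hWp : ∀ a b, W a b ≤ p := fun a b ↦ by rw [hE]; split_ifs <;> linarith
  have hsplit : ∀ {b c : V}, a ≠ c → b ≠ c → ∏ d ∈ ({a, b} : Finset V)ᶜ, (1 - W a d * W b d) =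
      (1 - W a c * W b c) * ∏ d ∈ ({a, b, c} : Finset V)ᶜ, (1 - W a d * W b d) := by
    intro b c hac hbc
    rw [show ({a, b} : Finset V)ᶜ = insert c ({a, b, c} : Finset V)ᶜ by ext; simp; grind,
      Finset.prod_insert (by simp)]
  have hfac : ∏ d ∈ ({a, b, c} : Finset V)ᶜ, (1 - W a d * (1 - (1 - W b d) * (1 - W c d))) ≤
      R ^ outsideCard part (part a) (part a) *
      ((∏ d ∈ ({a, b, c} : Finset V)ᶜ, (1 - W a d * W b d)) *
        ∏ d ∈ ({a, b, c} : Finset V)ᶜ, (1 - W a d * W c d)) := by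
    have hRprod : ∏ d ∈ ({a, b, c} : Finset V)ᶜ, (if part d ≠ part a then R else 1) ≤
        R ^ outsideCard part (part a) (part a) := by
      calc _ ≤ ∏ d : V, (if part d ≠ part a then R else 1) :=
            Finset.prod_le_prod_of_subset_of_one_le (Finset.subset_univ _)
              (fun d _ ↦ by split_ifs <;> linarith) (fun d _ _ ↦ by split_ifs <;> linarith)
        _ = _ := by rw [Finset.prod_ite]; simp [outsideCard]
    rw [← Finset.prod_mul_distrib]
    refine le_trans ?_ (mul_le_mul_of_nonneg_right hRprod
      (Finset.prod_nonneg fun d _ ↦ (mul_pos (hpos _ _ _ _) (hpos _ _ _ _)).le))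
    rw [← Finset.prod_mul_distrib]
    refine Finset.prod_le_prod (fun d _ ↦ ?_) (fun d _ ↦ ?_)
    · have h1 : 0 ≤ (1 - W b d) * (1 - W c d) :=
        mul_nonneg (by linarith [hWp b d]) (by linarith [hWp c d])
      nlinarith [hW0 a d, hWp a d]
    · rw [hE a d, hE b d, hE c d]
      by_cases h1 : part d = part a
      · simp [h1]
      · rw [if_neg (Ne.symm h1), if_pos h1]
        have hx1 : 1 - (p : ℝ) ^ 2 ≤ 1 := by nlinarith
        split_ifs
        · simpa using hR1
        · nlinarith [mul_nonneg hx.le (sub_nonneg.2 hR1)]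
        · nlinarith [mul_nonneg hx.le (sub_nonneg.2 hR1)]
        -- With all three edges possible the exact ratio is 1 + p³/((1-p)(1+p)²); `R` drops the
        -- factor (1+p)².
        · have : (1 - (p : ℝ) * p) * (1 - p * p) * (p ^ 3 / (1 - p)) =
              p ^ 3 * (1 - p) * (1 + p) ^ 2 := by field_simp; ring
          rw [hR, one_add_mul, mul_comm (_ / _), this]
          nlinarith [mul_nonneg (mul_nonneg (pow_nonneg hp0 3) hq.le) 
            (by positivity : 0 ≤ p * (p + 2 : ℝ))]
  have hle := setBernoulli_real_badPair_inter_badPair_le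
    (u := (multipartiteGraph part).edgeSet) (p := p) hab hac hbc
  rw [← hW] at hle
  rw [edgeLaw, setBernoulli_real_badPair hab, setBernoulli_real_badPair hac, ← hW, hsplit hac hbc,
    hsplit hab hbc.symm, show ({a, c, b} : Finset V) = {a, b, c} by ext; simp; grind]
  have hcross : ∀ a b c d, 1 - (p : ℝ) ^ 2 ≤ 1 - W a b * W c d := fun a b c d ↦ by
    nlinarith [mul_le_mul (hWp a b) (hWp c d) (hW0 c d) hp0]
  have hx2 : (1 - (p : ℝ) ^ 2) ^ 2 ≤ (1 - W a c * W b c) * (1 - W a b * W c b) := by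
    rw [sq]; exact mul_le_mul (hcross _ _ _ _) (hcross _ _ _ _) hx.le (hpos _ _ _ _).le
  have hab1 : 0 ≤ 1 - W a b := by linarith [hWp a b]
  have hac1 : 0 ≤ 1 - W a c := by linarith [hWp a c]
  calc _ ≤ ((1 - W a c * W b c) * (1 - W a b * W c b)) * ((1 - W a b) * (1 - W a c) * (_)) :=
        mul_le_mul hx2 (hle.trans (mul_le_mul_of_nonneg_left hfac (by positivity)))
          measureReal_nonneg (mul_pos (hpos _ _ _ _) (hpos _ _ _ _)).le
    _ = _ := by ring

/-- Midpoints outside the quadruple give identical factors on both sides, so only the 4-cycle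
between the two pairs matters, and this is a check over which of its edges are possible. -/
lemma edgeLaw_real_badPair_inter_badPair_le_of_disjoint {a b c d : V} (hab : a ≠ b)
    (hac : a ≠ c) (had : a ≠ d) (hbc : b ≠ c) (hbd : b ≠ d) (hcd : c ≠ d) :
    (1 - (p : ℝ) ^ 2) ^ 2 * (edgeLaw part p).real (badPair a b ∩ badPair c d) ≤
      ((1 - (p : ℝ) ^ 2) ^ 2 + 4 * (p : ℝ) ^ 3) *
      ((edgeLaw part p).real (badPair a b) * (edgeLaw part p).real (badPair c d)) := by
  have hx := one_sub_sq_pos p hp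
  have hp0 : (0 : ℝ) ≤ p := p.2.1
  have hq : 0 < 1 - (p : ℝ) := by linarith
  have hE := edgeProb_multipartiteGraph part p
  have hpos := one_sub_edgeProb_mul_pos part p hp
  have hcyc : ∀ α β γ δ : ℝ, (α = 0 ∨ α = p) → (β = 0 ∨ β = p) → (γ = 0 ∨ γ = p) →
      (δ = 0 ∨ δ = p) → (1 - (p : ℝ) ^ 2) ^ 2 *
        (1 - (1 - (1 - α) * (1 - γ)) * (1 - (1 - β) * (1 - δ))) ≤
      ((1 - (p : ℝ) ^ 2) ^ 2 + 4 * (p : ℝ) ^ 3) *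
        ((1 - α * β) * (1 - δ * γ) * ((1 - α * δ) * (1 - β * γ))) := by
    -- Up to constants these are the nonzero differences of the two sides: `h0` when two opposite
    -- edges or fewer are possible without consecutive ones, `h2` for two consecutive edges, `h3`
    -- for three, `h4` for four.
    have h0 : 0 ≤ (p : ℝ) ^ 3 := by positivity
    have h2 : 0 ≤ (p : ℝ) ^ 3 * (1 - p ^ 2) := by positivity
    have h3 : 0 ≤ (p : ℝ) ^ 3 * (1 - p ^ 2) ^ 2 * (3 + p) := by positivity
    have h4 : 0 ≤ (1 - (p : ℝ) ^ 2) ^ 2 * (1 - p) ^ 2 * p ^ 4 * (7 + 6 * p + p ^ 2) := by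
      positivity
    rintro α β γ δ (rfl | rfl) (rfl | rfl) (rfl | rfl) (rfl | rfl)
    all_goals first
      | linarith only [h0] | linarith only [h2] | linarith only [h3] | linarith only [h4]
  set W := edgeProb (multipartiteGraph part).edgeSet p with hW
  have hWp : ∀ a b, W a b ≤ p := fun a b ↦ by rw [hE]; split_ifs <;> linarith
  have hW01 : ∀ a b, W a b = 0 ∨ W a b = p := fun a b ↦ by rw [hE]; split_ifs <;> simp
  have hsplit : ∀ {a b c d : V}, a ≠ c → a ≠ d → b ≠ c → b ≠ d → c ≠ d →
      ∏ e ∈ ({a, b} : Finset V)ᶜ, (1 - W a e * W b e) =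
      (1 - W a c * W b c) * (1 - W a d * W b d) *
        ∏ e ∈ ({a, b, c, d} : Finset V)ᶜ, (1 - W a e * W b e) := by
    intro a b c d hac had hbc hbd hcd
    rw [show ({a, b} : Finset V)ᶜ = insert c (insert d ({a, b, c, d} : Finset V)ᶜ) by
      ext; simp; grind, Finset.prod_insert (by simp [hcd]), Finset.prod_insert (by simp), mul_assoc]
  have hcomm : ∀ a b, W a b = W b a := fun a b ↦ by simp only [hE, eq_comm]
  have hle := setBernoulli_real_badPair_inter_badPair_le_of_disjoint
    (u := (multipartiteGraph part).edgeSet) (p := p) hab hac had hbc hbd hcd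
  rw [← hW, Finset.prod_mul_distrib] at hle
  rw [edgeLaw, setBernoulli_real_badPair hab, setBernoulli_real_badPair hcd, ← hW,
    hsplit hac had hbc hbd hcd, hsplit hac.symm hbc.symm had.symm hbd.symm hab,
    show ({c, d, a, b} : Finset V) = {a, b, c, d} by ext; simp; grind]
  have hab1 : 0 ≤ 1 - W a b := by linarith [hWp a b]
  have hcd1 : 0 ≤ 1 - W c d := by linarith [hWp c d]
  set P := ∏ e ∈ ({a, b, c, d} : Finset V)ᶜ, (1 - W a e * W b e)
  set Q := ∏ e ∈ ({a, b, c, d} : Finset V)ᶜ, (1 - W c e * W d e)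
  have hP : 0 ≤ P := Finset.prod_nonneg fun e _ ↦ (hpos _ _ _ _).le
  have hQ : 0 ≤ Q := Finset.prod_nonneg fun e _ ↦ (hpos _ _ _ _).le
  have hc := hcyc (W a c) (W b c) (W b d) (W a d) (hW01 _ _) (hW01 _ _) (hW01 _ _) (hW01 _ _)
  calc _ ≤ (1 - (p : ℝ) ^ 2) ^ 2 * _ := mul_le_mul_of_nonneg_left hle (by positivity)
    _ = (1 - W a b) * (1 - W c d) * (P * Q) * ((1 - (p : ℝ) ^ 2) ^ 2 *
      (1 - (1 - (1 - W a c) * (1 - W b d)) * (1 - (1 - W b c) * (1 - W a d)))) := by ring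
    _ ≤ (1 - W a b) * (1 - W c d) * (P * Q) * _ := mul_le_mul_of_nonneg_left hc (by positivity)
    _ = _ := by rw [hcomm c a, hcomm d a, hcomm c b, hcomm d b]; ring

end Multipartite

/-! ### First and second moment bounds. -/

section Moments

variable {Ω α : Type*} [Finite Ω] [MeasurableSpace Ω] [MeasurableSingletonClass Ω]
  (μ : Measure Ω) [IsProbabilityMeasure μ] (Q : Finset α) (B : α → Set Ω)

/-- Second moment method: the probability that none of finitely many events occurs. -/
lemma measureReal_biInter_compl_mul_sq_le :
    μ.real (⋂ q ∈ Q, (B q)ᶜ) * (∑ q ∈ Q, μ.real (B q)) ^ 2 ≤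
      ∑ q ∈ Q, ∑ r ∈ Q, μ.real (B q ∩ B r) - (∑ q ∈ Q, μ.real (B q)) ^ 2 := by
  classical
  have hm : ∀ A : Set Ω, MeasurableSet A := fun A ↦ A.toFinite.measurableSet
  have hi : ∀ A : Set Ω, ∫ ω, A.indicator (1 : Ω → ℝ) ω ∂μ = μ.real A := fun A ↦
    integral_indicator_one (hm A)
  have hint : ∀ f : Ω → ℝ, Integrable f μ := fun f ↦ .of_finite
  set E := ∑ q ∈ Q, μ.real (B q) with hE
  have hX : ∫ ω, ∑ q ∈ Q, (B q).indicator (1 : Ω → ℝ) ω ∂μ = E := by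
    rw [integral_finsetSum _ fun _ _ ↦ hint _]; simp only [hi, hE]
  have hX2 : ∫ ω, (∑ q ∈ Q, (B q).indicator (1 : Ω → ℝ) ω) ^ 2 ∂μ =
      ∑ q ∈ Q, ∑ r ∈ Q, μ.real (B q ∩ B r) := by
    simp only [sq, Finset.sum_mul_sum]
    rw [integral_finsetSum _ fun _ _ ↦ hint _]
    refine Finset.sum_congr rfl fun q _ ↦ ?_
    rw [integral_finsetSum _ fun _ _ ↦ hint _]
    refine Finset.sum_congr rfl fun r _ ↦ ?_
    rw [← hi, Set.inter_indicator_one]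
    rfl
  calc μ.real (⋂ q ∈ Q, (B q)ᶜ) * E ^ 2
      = ∫ ω, (⋂ q ∈ Q, (B q)ᶜ).indicator (1 : Ω → ℝ) ω * E ^ 2 ∂μ := by
        rw [integral_mul_const, hi]
    -- Where no event occurs the count is 0 and its squared deviation is exactly `E ^ 2`.
    _ ≤ ∫ ω, ((∑ q ∈ Q, (B q).indicator (1 : Ω → ℝ) ω) - E) ^ 2 ∂μ := by
        refine integral_mono (hint _) (hint _) fun ω ↦ ?_
        by_cases hω : ω ∈ ⋂ q ∈ Q, (B q)ᶜ
        · have : ∑ q ∈ Q, (B q).indicator (1 : Ω → ℝ) ω = 0 :=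
            Finset.sum_eq_zero fun q hq ↦ by
              simp only [Set.mem_iInter] at hω
              exact Set.indicator_of_notMem (hω q hq) _
          simp [this, Set.indicator_of_mem hω]
        · simp only [Set.indicator_of_notMem hω, zero_mul]
          positivity
    _ = ∫ ω, (∑ q ∈ Q, (B q).indicator (1 : Ω → ℝ) ω) ^ 2
          - 2 * E * (∑ q ∈ Q, (B q).indicator (1 : Ω → ℝ) ω) + E ^ 2 ∂μ := by
        congr 1; ext ω; ring
    _ = _ := by
        rw [integral_add (hint _) (hint _), integral_sub (hint _) (hint _), integral_const_mul,
          hX, hX2]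
        simp
        ring

/-- A union bound for events each of which occurs under two different indices. -/
lemma one_sub_le_measureReal_biInter_compl
    (hB : ∀ q ∈ Q, ∃ r ∈ Q, r ≠ q ∧ B r = B q) :
    1 - (∑ q ∈ Q, μ.real (B q)) / 2 ≤ μ.real (⋂ q ∈ Q, (B q)ᶜ) := by
  classical
  have hm : ∀ A : Set Ω, MeasurableSet A := fun A ↦ A.toFinite.measurableSet
  have hi : ∀ A : Set Ω, ∫ ω, A.indicator (1 : Ω → ℝ) ω ∂μ = μ.real A := fun A ↦
    integral_indicator_one (hm A)
  have hint : ∀ f : Ω → ℝ, Integrable f μ := fun f ↦ .of_finite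
  have hX : ∫ ω, (1 - (∑ q ∈ Q, (B q).indicator (1 : Ω → ℝ) ω) / 2) ∂μ =
      1 - (∑ q ∈ Q, μ.real (B q)) / 2 := by
    rw [integral_sub (hint _) (hint _), integral_div, integral_finsetSum _ fun _ _ ↦ hint _]
    simp [hi]
  rw [← hX, ← hi]
  refine integral_mono (hint _) (hint _) fun ω ↦ ?_
  have h0 : ∀ q ∈ Q, 0 ≤ (B q).indicator (1 : Ω → ℝ) ω := fun q _ ↦
    Set.indicator_nonneg (fun _ _ ↦ zero_le_one) _
  by_cases hω : ω ∈ ⋂ q ∈ Q, (B q)ᶜ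
  · simp only [Set.indicator_of_mem hω, Pi.one_apply]
    linarith [Finset.sum_nonneg h0]
  · simp only [Set.indicator_of_notMem hω]
    simp only [Set.mem_iInter, not_forall, Set.mem_compl_iff, not_not] at hω
    obtain ⟨q, hq, hqω⟩ := hω
    obtain ⟨r, hr, hrq, hBr⟩ := hB q hq
    have h2 : ∑ i ∈ {q, r}, (B i).indicator (1 : Ω → ℝ) ω ≤
        ∑ i ∈ Q, (B i).indicator (1 : Ω → ℝ) ω :=
      Finset.sum_le_sum_of_subset_of_nonneg (by grind) fun i hi _ ↦ h0 i hi
    rw [Finset.sum_pair hrq.symm, hBr, Set.indicator_of_mem hqω, Pi.one_apply] at h2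
    linarith

end Moments

/-! ### Diameter 2 as the absence of bad pairs. -/

section Diameter

variable {V : Type*} [Fintype V] [DecidableEq V] {k : ℕ} (part : V → Fin k) (p : unitInterval)

lemma probDiamTwo_eq (h2 : ∃ a b : V, a ≠ b ∧ part a = part b) :
    probDiamTwo part p = (edgeLaw part p).real
      (⋂ q ∈ (Finset.univ : Finset V).offDiag, (badPair q.1 q.2)ᶜ) := by
  have hmeas : MeasurableSet {G : SimpleGraph V | G.ediam = 2} := by
    rw [← SimpleGraph.measurableEmbedding_edgeSet.measurableSet_image]
    exact measurableSet_setSet _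
  rw [probDiamTwo, randomSubgraph, map_measureReal_apply SimpleGraph.measurable_fromEdgeSet hmeas]
  refine measureReal_congr ?_
  -- Almost surely `s` contains only edges between different parts, in particular no loops, so
  -- `fromEdgeSet` discards nothing.
  filter_upwards [setBernoulli_ae_subset] with s hs
  refine propext ?_
  change SimpleGraph.ediam (SimpleGraph.fromEdgeSet s) = 2 ↔
    s ∈ ⋂ q ∈ (Finset.univ : Finset V).offDiag, (badPair q.1 q.2)ᶜ
  set G := SimpleGraph.fromEdgeSet s with hG
  have hadj : ∀ a b, G.Adj a b ↔ s(a, b) ∈ s := by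
    intro a b
    rw [hG, SimpleGraph.fromEdgeSet_adj, and_iff_left_iff_imp]
    intro h
    exact ((multipartiteGraph part).mem_edgeSet.1 (hs h)).ne
  have hpart : ∀ a b, s(a, b) ∈ s → part a ≠ part b := fun a b h ↦ by
    simpa [multipartiteGraph] using hs h
  have hbad : ∀ a b, a ≠ b → (s ∈ badPair a b ↔ 2 < G.edist a b) := by
    intro a b hab
    rw [SimpleGraph.two_lt_edist_iff, hadj]
    simp only [badPair, Set.mem_ofPred_eq, Set.eq_empty_iff_forall_notMem,
      SimpleGraph.mem_commonNeighbors, hadj]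
    have : ∀ c, s(a, c) ∈ s ∧ s(b, c) ∈ s → c ≠ a ∧ c ≠ b := fun c hc ↦
      ⟨fun h ↦ hpart _ _ hc.1 (by rw [h]), fun h ↦ hpart _ _ hc.2 (by rw [h])⟩
    grind
  have hle : s ∈ (⋂ q ∈ (Finset.univ : Finset V).offDiag, (badPair q.1 q.2)ᶜ) ↔
      G.ediam ≤ 2 := by
    rw [SimpleGraph.ediam_le_iff]
    simp only [Set.mem_iInter, Finset.mem_offDiag, Finset.mem_univ, true_and, Prod.forall,
      Set.mem_compl_iff]
    refine forall₂_congr fun a b ↦ ?_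
    by_cases hab : a = b
    · simp [hab]
    · simp [hab, hbad a b hab]
  rw [hle]
  refine ⟨le_of_eq, fun h ↦ h.antisymm ?_⟩
  obtain ⟨a, b, hab, hpab⟩ := h2
  have h1 : ¬ G.edist a b ≤ 1 := by
    rw [SimpleGraph.edist_le_one_iff_adj_or_eq, hadj]
    exact fun h ↦ h.elim (hpart _ _ · hpab) hab
  refine le_trans ?_ (SimpleGraph.edist_le_ediam (u := a) (v := b))
  rw [← one_add_one_eq_two]
  exact Order.add_one_le_of_lt (not_le.1 h1)

end Diameter

/-! ### The second moment of the number of bad ordered pairs. -/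

section SecondMoment

variable {V ι : Type*} [Fintype V] [DecidableEq V] [DecidableEq ι] (part : V → ι)
  (p : unitInterval)

/-- The expected number of vertices that form with `a` a pair of distinct vertices which are neither
adjacent nor have a common neighbour. -/
noncomputable def badDegree (a : V) : ℝ :=
  ∑ b, if a ≠ b then badWeight part p (part a) (part b) else 0

omit [DecidableEq V] in
lemma badWeight_comm (i j : ι) : badWeight part p i j = badWeight part p j i := by
  simp only [badWeight, outsideCard, and_comm, eq_comm]

lemma sum_offDiag_eq (f : V → V → ℝ) :
    ∑ q ∈ (Finset.univ : Finset V).offDiag, f q.1 q.2 =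
      ∑ a, ∑ b, if a ≠ b then f a b else 0 := by
  rw [← Finset.sum_product' Finset.univ Finset.univ fun a b ↦ if a ≠ b then f a b else 0,
    ← Finset.sum_filter]
  congr 1
  ext q; simp

lemma sum_badDegree : ∑ a, badDegree part p a = ∑ q ∈ (Finset.univ : Finset V).offDiag,
    badWeight part p (part q.1) (part q.2) :=
  (sum_offDiag_eq fun a b ↦ badWeight part p (part a) (part b)).symm

lemma sum_offDiag_ite_fst (c : V) :
    ∑ q ∈ (Finset.univ : Finset V).offDiag,
      (if c = q.1 then badWeight part p (part q.1) (part q.2) else 0) = badDegree part p c := by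
  rw [sum_offDiag_eq fun a b ↦ if c = a then badWeight part p (part a) (part b) else 0,
    Finset.sum_eq_single c, badDegree]
  · simp
  · intro a _ ha; simp [ha.symm]
  · simp

lemma sum_offDiag_ite_snd (c : V) :
    ∑ q ∈ (Finset.univ : Finset V).offDiag,
      (if c = q.2 then badWeight part p (part q.1) (part q.2) else 0) = badDegree part p c := by
  rw [sum_offDiag_eq fun a b ↦ if c = b then badWeight part p (part a) (part b) else 0,
    Finset.sum_comm, Finset.sum_eq_single c, badDegree]
  · simp only [if_true]
    refine Finset.sum_congr rfl fun b _ ↦ ?_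
    rw [badWeight_comm]; simp only [ne_comm]
  · intro a _ ha; simp [ha.symm]
  · simp

variable {part p}

/-- For fixed `q`, the pairs `r` are sorted by overlap. The coefficient 4 counts the ways in which a
coordinate of `q` can equal one of `r`, each of total weight at most `M`; the 2 comes from `r = q`
and `r = q.swap`. -/
lemma sum_sum_edgeLaw_real_inter_le (hp : (p : ℝ) < 1) {K M : ℝ} (hK0 : 0 ≤ K)
    (hK : ∀ i, (1 + (p : ℝ) ^ 3 / (1 - p)) ^ outsideCard part i i ≤ K)
    (hM : ∀ a, badDegree part p a ≤ M) :
    ∑ q ∈ (Finset.univ : Finset V).offDiag, ∑ r ∈ (Finset.univ : Finset V).offDiag,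
      (edgeLaw part p).real (badPair q.1 q.2 ∩ badPair r.1 r.2) ≤
    (∑ a, badDegree part p a) * ((1 + 4 * (p : ℝ) ^ 3 / (1 - (p : ℝ) ^ 2) ^ 2) *
      (∑ a, badDegree part p a) + 4 * (K / (1 - (p : ℝ) ^ 2) ^ 2) * M + 2) := by
  have hx := one_sub_sq_pos p hp
  have hp0 : (0 : ℝ) ≤ p := p.2.1
  have hq : 0 < 1 - (p : ℝ) := by linarith
  set x : ℝ := 1 - (p : ℝ) ^ 2 with hxdef
  set E := ∑ a, badDegree part p a with hE
  set w : V × V → ℝ := fun q ↦ badWeight part p (part q.1) (part q.2) with hw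
  have hw0 : ∀ q, 0 ≤ w q := fun q ↦ by
    simp only [hw, badWeight, ← hxdef]; split_ifs <;> positivity
  have hPw : ∀ a b, a ≠ b → (edgeLaw part p).real (badPair a b) = w (a, b) := fun a b hab ↦
    edgeLaw_real_badPair part p hab
  have hwc : ∀ a b, w (a, b) = w (b, a) := fun a b ↦ badWeight_comm _ _ _ _
  have hEw : E = ∑ q ∈ (Finset.univ : Finset V).offDiag, w q := by rw [hE, sum_badDegree]
  have hK0 : 0 ≤ K / x ^ 2 := by positivity
  have hover : ∀ a b c, a ≠ b → a ≠ c → b ≠ c →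
      (edgeLaw part p).real (badPair a b ∩ badPair a c) ≤ K / x ^ 2 * (w (a, b) * w (a, c)) := by
    intro a b c hab hac hbc
    have h := edgeLaw_real_badPair_inter_badPair_le part p hp hab hac hbc
    rw [← hxdef, hPw a b hab, hPw a c hac] at h
    rw [div_mul_eq_mul_div, le_div_iff₀ (by positivity), mul_comm]
    exact h.trans (mul_le_mul_of_nonneg_right (hK _) (mul_nonneg (hw0 _) (hw0 _)))
  -- All summands are nonnegative, so the overlap types may be added without making them exclusive.
  have hpoint : ∀ q ∈ (Finset.univ : Finset V).offDiag,
      ∀ r ∈ (Finset.univ : Finset V).offDiag,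
      (edgeLaw part p).real (badPair q.1 q.2 ∩ badPair r.1 r.2) ≤
      w q * ((1 + 4 * (p : ℝ) ^ 3 / x ^ 2) * w r + K / x ^ 2 *
        ((if q.1 = r.1 then w r else 0) + (if q.1 = r.2 then w r else 0) +
          (if q.2 = r.1 then w r else 0) + (if q.2 = r.2 then w r else 0)) +
        ((if r = q then 1 else 0) + (if r = q.swap then 1 else 0))) := by
    rintro ⟨a, b⟩ hab ⟨c, d⟩ hcd
    simp only [Finset.mem_offDiag, Finset.mem_univ, true_and] at hab hcd
    simp only [Prod.mk.injEq, Prod.swap_prod_mk]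
    have hδ : 0 ≤ 4 * (p : ℝ) ^ 3 / x ^ 2 := by positivity
    have hsame : (edgeLaw part p).real (badPair a b ∩ badPair a b) = w (a, b) := by
      rw [Set.inter_self, hPw a b hab]
    have hwq := hw0 (a, b)
    have hwr := hw0 (c, d)
    have h1 : 0 ≤ w (a, b) * ((1 + 4 * (p : ℝ) ^ 3 / x ^ 2) * w (c, d)) := by positivity
    have h2 : 0 ≤ w (a, b) * (K / x ^ 2 * w (c, d)) := by positivity
    by_cases hac : a = c
    · subst hac
      by_cases hbd : b = d
      · subst hbd
        rw [hsame]
        simp [hab, hab.symm]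
        nlinarith
      · have := hover a b d hab hcd hbd
        simp [hab, hab.symm, hcd, hbd, Ne.symm hbd]
        nlinarith
    · by_cases had : a = d
      · subst had
        by_cases hbc : b = c
        · subst hbc
          rw [badPair_comm b a, hsame]
          simp [hab, hab.symm]
          nlinarith
        · have := hover a b c hab hac hbc
          rw [badPair_comm a c, hwc a c] at this
          simp [hab, hab.symm, hac, Ne.symm hac, hbc, Ne.symm hbc]
          nlinarith
      · by_cases hbc : b = c
        · subst hbc
          have := hover b a d hab.symm hcd had
          rw [badPair_comm b a, hwc b a] at this
          simp [hac, had, hcd, Ne.symm had, Ne.symm hac]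
          nlinarith
        · by_cases hbd : b = d
          · subst hbd
            have := hover b a c hab.symm hbc hac
            rw [badPair_comm b a, badPair_comm b c, hwc b a, hwc b c] at this
            simp [hac, had, hbc, Ne.symm hac, Ne.symm hbc]
            nlinarith
          · have := edgeLaw_real_badPair_inter_badPair_le_of_disjoint part p hp hab hac had hbc
              hbd hcd
            rw [← hxdef, hPw a b hab, hPw c d hcd, mul_comm, ← le_div_iff₀ (by positivity)] at this
            simp [hac, had, hbc, hbd, Ne.symm hac, Ne.symm had]
            refine this.trans_eq ?_
            field_simp
  calc _ ≤ ∑ q ∈ (Finset.univ : Finset V).offDiag, w q *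
        ((1 + 4 * (p : ℝ) ^ 3 / x ^ 2) * E + 4 * (K / x ^ 2) * M + 2) := by
        refine Finset.sum_le_sum fun q hq ↦ (Finset.sum_le_sum (hpoint q hq)).trans ?_
        rw [← Finset.mul_sum]
        refine mul_le_mul_of_nonneg_left ?_ (hw0 q)
        simp only [Finset.sum_add_distrib, ← Finset.mul_sum]
        rw [← hEw, sum_offDiag_ite_fst, sum_offDiag_ite_fst, sum_offDiag_ite_snd,
          sum_offDiag_ite_snd]
        have e1 : ∀ s : V × V, ∑ r ∈ (Finset.univ : Finset V).offDiag,
            (if r = s then (1 : ℝ) else 0) ≤ 1 := fun s ↦ by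
          rw [Finset.sum_ite_eq']; split_ifs <;> norm_num
        have e2 := mul_le_mul_of_nonneg_left (hM q.1) hK0
        have e3 := mul_le_mul_of_nonneg_left (hM q.2) hK0
        linarith [e1 q, e1 q.swap]
    _ = _ := by rw [← Finset.sum_mul, hEw]

end SecondMoment

/-! ### Estimates of the expectation from the part sizes. -/

section Sizes

variable {V ι : Type*} [Fintype V] [DecidableEq V] [DecidableEq ι] (part : V → ι)
  (p : unitInterval)

/-- The number of vertices of the part `i`. -/
def partCard (i : ι) : ℕ := Finset.card {v : V | part v = i}

omit [DecidableEq V] in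
lemma outsideCard_self_add (i : ι) : outsideCard part i i + partCard part i = Fintype.card V := by
  rw [outsideCard, partCard, add_comm]
  simpa using Finset.card_filter_add_card_filter_not (s := (Finset.univ : Finset V)) (part · = i)

omit [DecidableEq V] in
lemma outsideCard_add_add {i j : ι} (hij : i ≠ j) :
    outsideCard part i j + partCard part i + partCard part j = Fintype.card V := by
  rw [← outsideCard_self_add part i, add_assoc, add_comm (partCard part i), ← add_assoc]
  congr 1
  have h := Finset.card_filter_add_card_filter_not (s := ({v : V | part v ≠ i} : Finset V))
    (part · ≠ j)
  simp only [Finset.filter_filter, not_not] at h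
  rw [outsideCard, partCard, outsideCard]
  simp only [and_self]
  rw [← h]
  congr 2
  ext v; simp; grind

lemma badDegree_eq (a : V) : badDegree part p a =
    ((partCard part (part a) : ℝ) - 1) * badWeight part p (part a) (part a) +
      ∑ b with part b ≠ part a, badWeight part p (part a) (part b) := by
  have h1 : badDegree part p a =
      ∑ b, badWeight part p (part a) (part b) - badWeight part p (part a) (part a) := by
    rw [badDegree, eq_sub_iff_add_eq, ← Finset.sum_erase_add _ _ (Finset.mem_univ a)]
    simp only [ne_eq, not_true, if_false, add_zero]
    rw [← Finset.sum_erase_add _ (fun b ↦ badWeight part p (part a) (part b))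
      (Finset.mem_univ a)]
    congr 1
    refine Finset.sum_congr rfl fun b hb ↦ ?_
    rw [if_pos (Finset.ne_of_mem_erase hb).symm]
  rw [h1, ← Finset.sum_filter_add_sum_filter_not _ (fun b ↦ part b = part a)]
  have h2 : ∑ b with part b = part a, badWeight part p (part a) (part b) =
      partCard part (part a) * badWeight part p (part a) (part a) := by
    rw [partCard, ← nsmul_eq_mul, ← Finset.sum_const]
    refine Finset.sum_congr rfl fun b hb ↦ ?_
    rw [(Finset.mem_filter.1 hb).2]
  rw [h2]
  ring

lemma badDegree_congr {a b : V} (h : part a = part b) : badDegree part p a = badDegree part p b := by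
  rw [badDegree_eq, badDegree_eq, h]

variable {part p} {k : ℝ}

omit [DecidableEq V] in
lemma badWeight_nonneg (i j : ι) : 0 ≤ badWeight part p i j := by
  have h1 : 0 ≤ 1 - (p : ℝ) := sub_nonneg.2 p.2.2
  have h2 : 0 ≤ 1 - (p : ℝ) ^ 2 := sub_nonneg.2 (pow_le_one₀ p.2.1 p.2.2)
  rw [badWeight]
  split_ifs <;> positivity

lemma badDegree_nonneg (a : V) : 0 ≤ badDegree part p a :=
  Finset.sum_nonneg fun b _ ↦ by split_ifs <;> [exact badWeight_nonneg _ _; rfl]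

/-- `badDegree` is constant on each part. Hence no single vertex carries more than a 1/(part size)
share of the expectation, which controls the pairs sharing a vertex. -/
lemma partCard_mul_badDegree_le (a : V) :
    partCard part (part a) * badDegree part p a ≤ ∑ b, badDegree part p b := by
  rw [partCard, ← nsmul_eq_mul, ← Finset.sum_const]
  calc _ = ∑ b with part b = part a, badDegree part p b :=
        Finset.sum_congr rfl fun b hb ↦ badDegree_congr _ _ (Finset.mem_filter.1 hb).2.symm
    _ ≤ _ := Finset.sum_le_sum_of_subset_of_nonneg (Finset.subset_univ _)
        fun b _ _ ↦ badDegree_nonneg b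

variable {m : ℝ} (hp : (p : ℝ) < 1) (hlow : ∀ i, m - 1 ≤ partCard part i)
  (hup : ∀ i, (partCard part i : ℝ) ≤ m + 1)

omit [DecidableEq V] in
lemma card_ne_part (i : ι) : ((Finset.card {v : V | part v ≠ i} : ℕ) : ℝ) =
    Fintype.card V - partCard part i := by
  have := outsideCard_self_add part i
  rw [outsideCard] at this
  simp only [and_self] at this
  rw [← this]; push_cast; ring

include hp hlow in
lemma badDegree_le (hk : 2 ≤ k) (hn : (Fintype.card V : ℝ) = m * k) (a : V)
    (hup : ∀ i, (partCard part i : ℝ) ≤ m + 1) (hm : 1 ≤ m) :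
    badDegree part p a ≤ (m + 1) * (1 - (p : ℝ) ^ 2) ^ (Fintype.card V - m - 1) *
      (1 + (k - 1) * (1 - (p : ℝ) ^ 2) ^ (- m - 1)) := by
  have hx := one_sub_sq_pos p hp
  have hx1 : 1 - (p : ℝ) ^ 2 ≤ 1 := by nlinarith
  rw [badDegree_eq]
  have h1 : badWeight part p (part a) (part a) ≤
      (1 - (p : ℝ) ^ 2) ^ (Fintype.card V - m - 1) := by
    rw [badWeight, if_pos rfl, one_mul, ← Real.rpow_natCast _ (outsideCard _ _ _)]
    refine Real.rpow_le_rpow_of_exponent_ge hx hx1 ?_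
    have := outsideCard_self_add part (part a)
    rw [← this]; push_cast; linarith [hup (part a)]
  have h2 : ∀ b ∈ ({b | part b ≠ part a} : Finset V), badWeight part p (part a) (part b) ≤
      (1 - (p : ℝ) ^ 2) ^ (Fintype.card V - m - 1) * (1 - (p : ℝ) ^ 2) ^ (- m - 1) := by
    intro b hb
    have hne : part a ≠ part b := fun h ↦ (Finset.mem_filter.1 hb).2 h.symm
    rw [badWeight, if_neg hne, ← Real.rpow_natCast _ (outsideCard _ _ _), ← Real.rpow_add hx]
    -- The non-adjacency factor 1-p is discarded here; the lower estimate keeps it.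
    refine (mul_le_of_le_one_left (by positivity) (by linarith [p.2.1])).trans ?_
    refine Real.rpow_le_rpow_of_exponent_ge hx hx1 ?_
    have := outsideCard_add_add part hne
    rw [← this]; push_cast; linarith [hup (part a), hup (part b)]
  have h3 := Finset.sum_le_card_nsmul _ _ _ h2
  rw [nsmul_eq_mul, card_ne_part] at h3
  set y := (1 - (p : ℝ) ^ 2) ^ (Fintype.card V - m - 1)
  set z := (1 - (p : ℝ) ^ 2) ^ (- m - 1)
  have hy : 0 < y := by positivity
  have hz : 0 < z := by positivity
  have hs1 := hlow (part a)
  have hs2 := hup (part a)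
  have e1 : ((partCard part (part a) : ℝ) - 1) * badWeight part p (part a) (part a) ≤
      (m + 1) * y :=
    mul_le_mul (by linarith) h1 (badWeight_nonneg _ _) (by linarith)
  -- With part size at least m-1 this reduces to mk-m+1 ≤ (m+1)(k-1), that is, `2 ≤ k`.
  have e2 : ((Fintype.card V : ℝ) - partCard part (part a)) * (y * z) ≤
      ((m + 1) * (k - 1)) * (y * z) :=
    mul_le_mul_of_nonneg_right (by nlinarith) (by positivity)
  linarith

include hp hlow hup in
-- A vertex has at least (m-1)-1 = m-2 other vertices in its part; this loss is the source of the
-- factor 1-2k/n.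
lemma le_badDegree (hk : 2 ≤ k) (hn : (Fintype.card V : ℝ) = m * k) (hm : 2 ≤ m) (a : V) :
    (m - 2) * ((1 - (p : ℝ) ^ 2) ^ (Fintype.card V - m + 1) *
      (1 + (k - 1) * (1 - (p : ℝ) ^ 2) ^ (1 - m) * (1 - p))) ≤ badDegree part p a := by
  have hx := one_sub_sq_pos p hp
  have hq : 0 < 1 - (p : ℝ) := by linarith
  have hx1 : 1 - (p : ℝ) ^ 2 ≤ 1 := by nlinarith
  rw [badDegree_eq]
  have h1 : (1 - (p : ℝ) ^ 2) ^ (Fintype.card V - m + 1) ≤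
      badWeight part p (part a) (part a) := by
    rw [badWeight, if_pos rfl, one_mul, ← Real.rpow_natCast _ (outsideCard _ _ _)]
    refine Real.rpow_le_rpow_of_exponent_ge hx hx1 ?_
    have := outsideCard_self_add part (part a)
    rw [← this]; push_cast; linarith [hlow (part a)]
  have h2 : ∀ b ∈ ({b | part b ≠ part a} : Finset V),
      (1 - (p : ℝ)) * ((1 - (p : ℝ) ^ 2) ^ (Fintype.card V - m + 1) *
        (1 - (p : ℝ) ^ 2) ^ (1 - m)) ≤ badWeight part p (part a) (part b) := by
    intro b hb
    have hne : part a ≠ part b := fun h ↦ (Finset.mem_filter.1 hb).2 h.symm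
    rw [badWeight, if_neg hne, ← Real.rpow_natCast _ (outsideCard _ _ _), ← Real.rpow_add hx]
    refine mul_le_mul_of_nonneg_left ?_ hq.le
    refine Real.rpow_le_rpow_of_exponent_ge hx hx1 ?_
    have := outsideCard_add_add part hne
    rw [← this]; push_cast; linarith [hlow (part a), hlow (part b)]
  have h3 := Finset.card_nsmul_le_sum _ _ _ h2
  rw [nsmul_eq_mul, card_ne_part] at h3
  set y := (1 - (p : ℝ) ^ 2) ^ (Fintype.card V - m + 1)
  set z := (1 - (p : ℝ) ^ 2) ^ (1 - m)
  have hy : 0 < y := by positivity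
  have hz : 0 < z := by positivity
  have hs1 := hlow (part a)
  have hs2 := hup (part a)
  have e1 : (m - 2) * y ≤
      ((partCard part (part a) : ℝ) - 1) * badWeight part p (part a) (part a) :=
    mul_le_mul (by linarith) h1 (by positivity) (by linarith)
  have e2 : ((m - 2) * (k - 1)) * ((1 - p) * (y * z)) ≤
      ((Fintype.card V : ℝ) - partCard part (part a)) * ((1 - p) * (y * z)) :=
    mul_le_mul_of_nonneg_right (by nlinarith) (by positivity)
  linarith

end Sizes

/-! ### The error term and the main theorem. -/

section Turan

variable {V : Type*} [Fintype V] [DecidableEq V] {k : ℕ} {part : V → Fin k} {p : unitInterval}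

omit [DecidableEq V] in
lemma IsTuranPartition.partCard_bounds (h : IsTuranPartition k part) (i : Fin k) :
    (Fintype.card V : ℝ) / k - 1 ≤ partCard part i ∧
      (partCard part i : ℝ) ≤ (Fintype.card V : ℝ) / k + 1 := by
  have h0 : (0 : ℝ) ≤ (Fintype.card V : ℝ) / k := by positivity
  have hi : (part ⁻¹' {i}).ncard = partCard part i := by
    rw [partCard, ← Set.ncard_coe_finset]
    congr 1
    ext v; simp
  have h1 := Nat.floor_le h0
  have h2 := Nat.lt_floor_add_one ((Fintype.card V : ℝ) / k)
  have h3 := Nat.ceil_lt_add_one h0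
  have h4 := Nat.le_ceil ((Fintype.card V : ℝ) / k)
  have h5 := h i
  rw [hi] at h5
  rcases h5 with h5 | h5 <;> rw [h5] <;> constructor <;> linarith

/-- The relative excess of the second moment is at most the error term of the upper bound. -/
lemma correlation_error_le {p n k K : ℝ} (hk : 3 ≤ k) (hn : 2 * k < n) (hp0 : 0 ≤ p) (hp : p < 1)
    (hK : K = (1 + p ^ 3 / (1 - p)) ^ (n * (1 - 1 / k) + 1)) :
    4 * p ^ 3 / (1 - p ^ 2) ^ 2 + 4 * (K / (1 - p ^ 2) ^ 2) * (1 / (n / k - 1)) ≤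
      4 * k ^ 3 * K * ((1 - p ^ 2) ^ 2)⁻¹ / (n * (k - 1)) * ((1 - 2 * k / n) ^ 4)⁻¹ := by
  have hk0 : 0 < k := by linarith
  have hn0 : 0 < n := by linarith
  have hq : 0 < 1 - p := by linarith
  have hx : 0 < 1 - p ^ 2 := by nlinarith
  set x := 1 - p ^ 2
  have hk1 : 0 < k - 1 := by linarith
  have hN : n * (1 - 1 / k) = n * (k - 1) / k := by field_simp
  have hN0 : 0 ≤ n * (1 - 1 / k) := by rw [hN]; positivity
  have hp3 : p ^ 3 ≤ p ^ 3 / (1 - p) := le_div_self (by positivity) hq (by linarith)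
  -- Bernoulli's inequality makes `K` at least of order n·p³, so the excess from disjoint pairs can
  -- be charged to `K`.
  have hbern := one_add_mul_self_le_rpow_one_add (s := p ^ 3 / (1 - p))
    (le_trans (by norm_num) (by positivity : (0 : ℝ) ≤ p ^ 3 / (1 - p)))
    (p := n * (1 - 1 / k) + 1) (by linarith)
  rw [← hK] at hbern
  have hr0 : 0 ≤ p ^ 3 / (1 - p) := by positivity
  have hK1 : n * (k - 1) / k * p ^ 3 ≤ K := by
    rw [← hN]
    nlinarith [mul_le_mul_of_nonneg_left hp3 hN0]
  have hKpos : 0 < K := by rw [hK]; positivity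
  have hp3K : p ^ 3 ≤ k * K / (n * (k - 1)) := by
    rw [le_div_iff₀ (by positivity)]
    rw [div_mul_eq_mul_div, div_le_iff₀ hk0] at hK1
    linarith
  set t := 2 * k / n with ht
  have ht0 : 0 < t := by positivity
  have ht1 : t < 1 := by rw [ht, div_lt_one hn0]; exact hn
  have hD4 : 0 < (1 - t) ^ 4 := pow_pos (by linarith) 4
  have hD : 1 ≤ ((1 - t) ^ 4)⁻¹ := by
    rw [one_le_inv₀ hD4]; exact pow_le_one₀ (by linarith) (by linarith)
  have hm : 1 / (n / k - 1) ≤ k / n * ((1 - t) ^ 4)⁻¹ := by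
    have hnk : 0 < n / k - 1 := by rw [sub_pos, lt_div_iff₀ hk0]; linarith
    have e : n / k - 1 = n / k * (1 - t / 2) := by rw [ht]; field_simp
    rw [e, one_div, mul_inv, inv_div]
    refine mul_le_mul_of_nonneg_left (inv_anti₀ hD4 ?_) (by positivity)
    calc (1 - t) ^ 4 ≤ (1 - t) ^ 1 :=
          pow_le_pow_of_le_one (by linarith) (by linarith) (by norm_num)
      _ ≤ _ := by linarith
  set D := ((1 - t) ^ 4)⁻¹
  calc _ = 4 * (x ^ 2)⁻¹ * (p ^ 3 + K * (1 / (n / k - 1))) := by ring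
    _ ≤ 4 * (x ^ 2)⁻¹ * (k * K / (n * (k - 1)) * D + K * (k / n * D)) := by
        refine mul_le_mul_of_nonneg_left (add_le_add (hp3K.trans ?_)
          (mul_le_mul_of_nonneg_left hm hKpos.le)) (by positivity)
        exact le_mul_of_one_le_right (by positivity) hD
    -- The two contributions add up by 1/(k-1) + 1 = k/(k-1).
    _ = 4 * (x ^ 2)⁻¹ * (k ^ 2 * K / (n * (k - 1)) * D) := by field_simp; ring
    _ ≤ 4 * (x ^ 2)⁻¹ * (k ^ 3 * K / (n * (k - 1)) * D) := by
        have : k ^ 2 ≤ k ^ 3 := pow_le_pow_right₀ (by linarith) (by norm_num)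
        gcongr
    _ = _ := by ring

end Turan

theorem mainTheorem5 (k n : ℕ) (hk : 3 ≤ k) (hn : 2 * k < n)
    {V : Type*} [Fintype V] (hV : Fintype.card V = n)
    (part : V → Fin k) (hpart : IsTuranPartition k part)
    (p : unitInterval) (hp : (p : ℝ) < 1) :
    probDiamTwo part p ≥
      1 - (n : ℝ) ^ 2 * (1 - (p : ℝ) ^ 2) ^ ((n : ℝ) * (1 - 1 / (k : ℝ)) - 1) / (2 * (k : ℝ))
          * (1 + ((k : ℝ) - 1) * (1 - (p : ℝ) ^ 2) ^ (-(n : ℝ) / (k : ℝ) - 1))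
          * (1 + (k : ℝ) / (n : ℝ)) ∧
    probDiamTwo part p ≤
      2 * (k : ℝ) / ((n : ℝ) ^ 2 * (1 - (p : ℝ) ^ 2) ^ ((n : ℝ) * (1 - 1 / (k : ℝ)) + 1))
          * (1 + ((k : ℝ) - 1) * (1 - (p : ℝ) ^ 2) ^ (1 - (n : ℝ) / (k : ℝ)) * (1 - (p : ℝ)))⁻¹
          * (1 - 2 * (k : ℝ) / (n : ℝ))⁻¹
        + 4 * (k : ℝ) ^ 3
            * (1 + (p : ℝ) ^ 3 / (1 - (p : ℝ))) ^ ((n : ℝ) * (1 - 1 / (k : ℝ)) + 1)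
            * ((1 - (p : ℝ) ^ 2) ^ 2)⁻¹ / ((n : ℝ) * ((k : ℝ) - 1))
          * ((1 - 2 * (k : ℝ) / (n : ℝ)) ^ 4)⁻¹ := by
  classical
  have hk3 : (3 : ℝ) ≤ k := by exact_mod_cast hk
  have hn2 : 2 * (k : ℝ) < n := by exact_mod_cast hn
  have hk0 : (0 : ℝ) < k := by linarith
  have hn0 : (0 : ℝ) < n := by linarith
  have hx := one_sub_sq_pos p hp
  have hp0 : (0 : ℝ) ≤ p := p.2.1
  have hq : 0 < 1 - (p : ℝ) := by linarith
  set m : ℝ := (n : ℝ) / k with hm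
  have hmk : (Fintype.card V : ℝ) = m * k := by rw [hV, hm]; field_simp
  have hm2 : 2 < m := by rw [hm, lt_div_iff₀ hk0]; exact hn2
  have hb : ∀ i, m - 1 ≤ partCard part i ∧ (partCard part i : ℝ) ≤ m + 1 := fun i ↦ by
    have := hpart.partCard_bounds i
    rwa [hV] at this
  have hlow := fun i ↦ (hb i).1
  have hup := fun i ↦ (hb i).2
  have h2 : ∃ a b : V, a ≠ b ∧ part a = part b := by
    have h1 : 1 < partCard part ⟨0, by omega⟩ := by
      have : (1 : ℝ) < partCard part ⟨0, by omega⟩ := by linarith [hlow ⟨0, by omega⟩]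
      exact_mod_cast this
    obtain ⟨a, ha, b, hb, hab⟩ := Finset.one_lt_card.1 h1
    exact ⟨a, b, hab, (Finset.mem_filter.1 ha).2.trans (Finset.mem_filter.1 hb).2.symm⟩
  rw [probDiamTwo_eq part p h2]
  have hsum : ∑ q ∈ (Finset.univ : Finset V).offDiag,
      (edgeLaw part p).real (badPair q.1 q.2) = ∑ a, badDegree part p a := by
    rw [sum_badDegree]
    exact Finset.sum_congr rfl fun q hq ↦
      edgeLaw_real_badPair part p (Finset.mem_offDiag.1 hq).2.2
  set E := ∑ a, badDegree part p a with hE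
  have hexp : (n : ℝ) * (1 - 1 / k) = n - m := by rw [hm]; ring
  constructor
  · have hfirst := one_sub_le_measureReal_biInter_compl (edgeLaw part p)
      (Finset.univ : Finset V).offDiag (fun q ↦ badPair q.1 q.2) fun q hq ↦
        ⟨q.swap, by simpa [eq_comm] using hq, fun h ↦
          (Finset.mem_offDiag.1 hq).2.2 (congrArg Prod.snd h), badPair_comm _ _⟩
    rw [hsum] at hfirst
    refine le_trans ?_ hfirst
    have hEle := Finset.sum_le_card_nsmul Finset.univ (badDegree part p) _ fun a _ ↦
      badDegree_le hp hlow (by linarith) hmk a hup (by linarith)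
    rw [nsmul_eq_mul, Finset.card_univ, hV, ← hE] at hEle
    rw [hexp, neg_div, ← hm]
    have : (n : ℝ) ^ 2 * (1 - (p : ℝ) ^ 2) ^ ((n : ℝ) - m - 1) / (2 * k) *
        (1 + (k - 1) * (1 - (p : ℝ) ^ 2) ^ (-m - 1)) * (1 + k / n) =
        n * ((m + 1) * (1 - (p : ℝ) ^ 2) ^ ((n : ℝ) - m - 1) *
          (1 + (k - 1) * (1 - (p : ℝ) ^ 2) ^ (-m - 1))) / 2 := by
      have hmn : m + 1 = n / k * (1 + k / n) := by rw [hm]; field_simp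
      rw [hmn]; ring
    rw [this]
    linarith
  · set K : ℝ := (1 + (p : ℝ) ^ 3 / (1 - p)) ^ ((n : ℝ) * (1 - 1 / k) + 1) with hK
    set Y : ℝ := (1 - (p : ℝ) ^ 2) ^ ((n : ℝ) - m + 1) *
      (1 + ((k : ℝ) - 1) * (1 - (p : ℝ) ^ 2) ^ (1 - m) * (1 - p)) with hY
    have hk1 : (0 : ℝ) < k - 1 := by linarith
    have hY0 : 0 < Y := by positivity
    have hEge : n * ((m - 2) * Y) ≤ E := by
      have h := Finset.card_nsmul_le_sum Finset.univ (badDegree part p) _ fun a _ ↦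
        le_badDegree hp hlow hup (by linarith) hmk hm2.le a
      rwa [nsmul_eq_mul, Finset.card_univ, hV] at h
    have hm20 : 0 < m - 2 := by linarith
    have hE0 : 0 < E := lt_of_lt_of_le (by positivity) hEge
    have hR1 : 1 ≤ 1 + (p : ℝ) ^ 3 / (1 - p) := le_add_of_nonneg_right (by positivity)
    have hKR : ∀ i, (1 + (p : ℝ) ^ 3 / (1 - p)) ^ outsideCard part i i ≤ K := by
      intro i
      rw [hK, ← Real.rpow_natCast]
      refine Real.rpow_le_rpow_of_exponent_le hR1 ?_
      have h := outsideCard_self_add part i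
      rw [hV] at h
      rw [hexp, ← h]; push_cast; linarith [hlow i]
    -- Each part has at least m-1 vertices, all of the same `badDegree`.
    have hM : ∀ a, badDegree part p a ≤ E * (1 / (m - 1)) := by
      intro a
      rw [mul_one_div, le_div_iff₀ (by linarith)]
      have := partCard_mul_badDegree_le (part := part) (p := p) a
      nlinarith [hlow (part a), badDegree_nonneg (part := part) (p := p) a]
    have hsec := measureReal_biInter_compl_mul_sq_le (edgeLaw part p)
      (Finset.univ : Finset V).offDiag (fun q ↦ badPair q.1 q.2)
    have hsm := sum_sum_edgeLaw_real_inter_le hp (by positivity) hKR hM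
    rw [hsum] at hsec
    rw [← hE] at hsm
    have herr := correlation_error_le hk3 hn2 hp0 hp hK
    rw [← hm] at herr
    have hcomb := hsec.trans (sub_le_sub_right hsm _)
    -- The first term of the bound is 2/E with `E` replaced by its lower estimate.
    have hfirst : 2 * (k : ℝ) / ((n : ℝ) ^ 2 * (1 - (p : ℝ) ^ 2) ^ ((n : ℝ) * (1 - 1 / k) + 1)) *
        (1 + ((k : ℝ) - 1) * (1 - (p : ℝ) ^ 2) ^ (1 - m) * (1 - p))⁻¹ *
        (1 - 2 * (k : ℝ) / n)⁻¹ = 2 / (n * ((m - 2) * Y)) := by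
      have hmn : m - 2 = n / k * (1 - 2 * k / n) := by rw [hm]; field_simp
      have ht : 1 - 2 * (k : ℝ) / n ≠ 0 := (sub_pos.2 ((div_lt_one hn0).2 hn2)).ne'
      rw [hexp, hmn, hY]
      generalize 1 - 2 * (k : ℝ) / n = t at ht ⊢
      field_simp
    rw [hfirst]
    refine le_trans ?_ (add_le_add (div_le_div_of_nonneg_left zero_le_two
      (by positivity) hEge) herr)
    refine le_of_mul_le_mul_right (hcomb.trans_eq ?_) (pow_pos hE0 2)
    field_simp
    ring
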